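/- Let $k\ge 1$, let $m_0=1$, and let $f_j:\mathbb R^n\times\mathbb R^{m_j}\times\mathbb R^m\to\mathbb R^{m_{j-1}}$ ($1\le j\le k$) and $f_{k+1}:\mathbb R^n\times\mathbb R^m\to\mathbb R^{m_k}$. Let $X$ be a random vector whose law $P$ is concentrated on $\mathcal X\subseteq\mathbb R^m$. Assume that for every $x\in\mathcal X$ the functions $(u,\eta)\mapsto f_j(u,\eta,x)$ and $u\mapsto f_{k+1}(u,x)$ are continuous. For a measure $Q$ on $\mathbb R^m$ put $$\bar f_j^{Q}(u,\eta)=\int f_j(u,\eta,x)\,Q(dx),\qquad \bar f_{k+1}^{Q}(u)=\int f_{k+1}(u,x)\,Q(dx),$$ $$\varrho^{Q}[u]=\bar f_1^{Q}\big(u,\bar f_2^{Q}(u,\cdots\bar f_k^{Q}(u,\bar f_{k+1}^{Q}(u))\cdots)\big),$$ and write $\varrho[u,X]=\varrho^{P}[u]$. Let $U\subseteq\mathbb R^n$ be closed, and assume that $f_j(u,\eta,\cdot)$ and $f_{k+1}(u,\cdot)$ are $P$-integrable for all $u\in U$, $\eta\in\mathbb R^{m_j}$. Let $S$ be the set of minimizers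 of $\varrho[\cdot,X]$ over $U$; assume that $S\neq\emptyset$, and let $\vartheta$ be the optimal value. Let $\mathcal U$ be a compact set with $S\subseteq\mathcal U\subseteq U$, and let $I_j\subset\mathbb R^{m_j}$, $1\le j\le k$, be compact sets such that $\bar f_{j}^{P}(\mathcal U\times I_{j})\subseteq\operatorname{int} I_{j-1}$ for $2\le j\le k$ and $\bar f_{k+1}^{P}(\mathcal U)\subseteq\operatorname{int} I_k$. Suppose that there are $P$-integrable functions $g_1,\dots,g_{k+1}:\mathbb R^m\to\mathbb R$ such that for all $x\in\mathcal X$ and $u\in\mathcal U$ one has $\|f_j(u,\eta,x)\|\le g_j(x)$ for all $1\le j\le k$, $\eta\in I_j$, and $\|f_{k+1}(u,x)\|\le g_{k+1}(x)$. Let $X_1,X_2,\dots$ be independent with law $P$, let $P_N=\frac1N\sum_{i=1}^N\delta_{X_i}$ be the empirical measure, and put $\varrho_E^{(N)}[u,X]=\varrho^{P_N}[u]$. Let $S_E^{(N)}$ be the set of minimizers of $\varrho_E^{(N)}[\cdot,X]$ over $U$ and let $\vartheta_E^{(N)}$ be the optimal value. Assume that, almost surely, $\emptyset\ne S_E^{(N)}\subseteq\mathcal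 U$ for all sufficiently large $N$. Then 1. for every $u\in\mathcal U$, $\varrho_E^{(N)}[u,X]\to\varrho[u,X]$ almost surely as $N\to\infty$; 2. $\vartheta_E^{(N)}\to\vartheta$ almost surely; 3. $\sup_{x\in S_E^{(N)}}\inf_{y\in S}\|x-y\|\to0$ almost surely; 4. if $S$ consists of a single point, then the Pompeiu–Hausdorff distance between $S_E^{(N)}$ and $S$ tends to $0$ almost surely. -/

import Mathlib

open MeasureTheory ProbabilityTheory Filter Topology

namespace CompositeOpt

/-- `Vec n` is `ℝⁿ` with the Euclidean norm. -/
abbrev Vec (n : ℕ) : Type := EuclideanSpace ℝ (Fin n)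

/-- The functions of a composite functional with `k + 1` levels, decision space `ℝⁿ` and data space
`ℝᵐ`.  With `m_i = dim i` (so `m_0 = 1`), the function `f_j : ℝⁿ × ℝ^{m_j} × ℝᵐ → ℝ^{m_{j-1}}`,
`1 ≤ j ≤ k`, is `f ⟨j - 1, _⟩`, and `f_{k+1} : ℝⁿ × ℝᵐ → ℝ^{m_k}` is `fLast`. -/
structure Model (n m : ℕ) where
  k : ℕ
  dim : Fin (k + 1) → ℕ
  dim_zero : dim 0 = 1
  f : (j : Fin k) → Vec n → Vec (dim j.succ) → Vec m → Vec (dim j.castSucc)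
  fLast : Vec n → Vec m → Vec (dim (Fin.last k))

namespace Model

variable {n m : ℕ} (F : Model n m) (Q : Measure (Vec m))

/-- `f̄_j^Q(u, η) = ∫ f_j(u, η, x) Q(dx)` for `1 ≤ j ≤ k`. -/
noncomputable def fbar (j : Fin F.k) (u : Vec n) (η : Vec (F.dim j.succ)) :
    Vec (F.dim j.castSucc) :=
  ∫ x, F.f j u η x ∂Q

/-- `f̄_{k+1}^Q(u) = ∫ f_{k+1}(u, x) Q(dx)`. -/
noncomputable def fbarLast (u : Vec n) : Vec (F.dim (Fin.last F.k)) :=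
  ∫ x, F.fLast u x ∂Q

/-- The nested values: `nested (Fin.last k) = f̄_{k+1}^Q(u)`, and
`nested (j - 1) = f̄_j^Q(u, nested j)` for `j = k, …, 1`. -/
noncomputable def nested (u : Vec n) (i : Fin (F.k + 1)) : Vec (F.dim i) :=
  Fin.reverseInduction (motive := fun i => Vec (F.dim i)) (F.fbarLast Q u)
    (fun j η => F.fbar Q j u η) i

/-- The composite functional
`ϱ^Q[u] = f̄_1^Q(u, f̄_2^Q(u, ⋯ f̄_k^Q(u, f̄_{k+1}^Q(u)) ⋯ ))`, as a real number
(the only coordinate of a vector of `ℝ^{m_0} = ℝ¹`).  For `Q` the law of the random vector `X`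
this is `ϱ[u, X]`. -/
noncomputable def risk (u : Vec n) : ℝ :=
  F.nested Q u 0 (Fin.cast F.dim_zero.symm 0)

theorem nested_last (u : Vec n) : F.nested Q u (Fin.last F.k) = F.fbarLast Q u := by
  simp [nested]

theorem nested_castSucc (u : Vec n) (j : Fin F.k) :
    F.nested Q u j.castSucc = F.fbar Q j u (F.nested Q u j.succ) := by
  simp [nested]

end Model

/-- The set of minimizers of `φ` over `U`. -/
def solutionSet {n : ℕ} (U : Set (Vec n)) (φ : Vec n → ℝ) : Set (Vec n) :=
  {u | u ∈ U ∧ IsMinOn φ U u}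

/-- The optimal value of `φ` over `U`; it is the minimum whenever `solutionSet U φ` is nonempty. -/
noncomputable def optimalValue {n : ℕ} (U : Set (Vec n)) (φ : Vec n → ℝ) : ℝ :=
  sInf (φ '' U)

theorem optimalValue_eq {n : ℕ} {U : Set (Vec n)} {φ : Vec n → ℝ} {u : Vec n}
    (hu : u ∈ solutionSet U φ) : optimalValue U φ = φ u :=
  IsLeast.csInf_eq ⟨⟨u, hu.1, rfl⟩, by rintro _ ⟨v, hv, rfl⟩; exact hu.2 hv⟩

/-- The one-sided distance `sup_{x ∈ A} inf_{y ∈ B} ‖x - y‖`, with values in `[0, ∞]`. -/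
noncomputable def oneSidedDist {n : ℕ} (A B : Set (Vec n)) : ENNReal :=
  ⨆ x ∈ A, Metric.infEDist x B

/-- The Pompeiu-Hausdorff distance, with values in `[0, ∞]`. -/
noncomputable def pompeiuHausdorffDist {n : ℕ} (A B : Set (Vec n)) : ENNReal :=
  max (oneSidedDist A B) (oneSidedDist B A)

/-- The empirical measure `P_N = (1/N) ∑_{i < N} δ_{x i}` of the first `N` sample points. -/
noncomputable def empiricalMeasure {m : ℕ} (x : ℕ → Vec m) (N : ℕ) : Measure (Vec m) :=
  (N : ENNReal)⁻¹ • ∑ i ∈ Finset.range N, Measure.dirac (x i)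

theorem integral_empiricalMeasure {m d : ℕ} (x : ℕ → Vec m) (N : ℕ) (h : Vec m → Vec d) :
    ∫ y, h y ∂(empiricalMeasure x N) = (N : ℝ)⁻¹ • ∑ i ∈ Finset.range N, h (x i) := by
  rw [empiricalMeasure, integral_smul_measure,
    integral_finsetSum_measure (fun i _ => integrable_dirac (by simp))]
  simp [integral_dirac]

end CompositeOpt

/-!
Everything follows from one almost sure event: the empirical functionals converge to `ϱ[·, X]`
uniformly on the compact set `K`, on which `ϱ[·, X]` is continuous.

At a single level, `f_j(·, ·, X_i)` restricted to the compact set `K × I_j` is a random element of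
the separable Banach space of continuous functions on it, and its norm is dominated by `g_j(X_i)`.
The strong law of large numbers for Banach-valued variables therefore gives continuity of the
averaged function and uniform convergence of its empirical versions (`uniform_strong_law`);
measurability into the function space comes from that of the evaluations
(`aemeasurable_continuousMap`).

The levels are put together by backward induction (`Model.nested_tendstoUniformlyOn`). The inner
values for `P` form a compact subset of the interior of `I_j`, so the empirical inner values
eventually lie in `I_j` as well, and uniform continuity of the averaged function on `K × I_j`
passes the uniform convergence on to the next level (`tendstoUniformlyOn_comp_prodMk`).

Since all minimizers lie in `K` for large `N`, uniform convergence yields convergence of the optimal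
values (`tendsto_optimalValue`). Away from the solution set the limit functional exceeds its minimum
by a positive gap, by compactness, so the empirical minimizers approach the solution set
(`tendsto_oneSidedDist_solutionSet`). If the solution set is a single point, the one-sided distance
is already the Pompeiu-Hausdorff distance (`pompeiuHausdorffDist_singleton`).
-/

namespace CompositeOpt

/-! ### A uniform strong law of large numbers -/

/-- A random continuous function on a compact space is a random element of the Banach space of
continuous functions: the restriction to a countable dense set is a continuous injection of one
Polish space into another, hence a measurable embedding. -/
theorem aemeasurable_continuousMap {T E D : Type*} [TopologicalSpace T] [CompactSpace T]
    [T2Space T] [SecondCountableTopology T] [NormedAddCommGroup E] [CompleteSpace E]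
    [SecondCountableTopology E] [MeasurableSpace E] [BorelSpace E]
    [MeasurableSpace C(T, E)] [BorelSpace C(T, E)] [MeasurableSpace D] {P : Measure D}
    {φ : D → C(T, E)} (hφ : ∀ t, AEMeasurable (fun x => φ x t) P) : AEMeasurable φ P := by
  obtain ⟨s, hsc, hsd⟩ := TopologicalSpace.exists_countable_dense T
  have : Countable s := hsc
  have hemb : MeasurableEmbedding (fun (h : C(T, E)) (t : s) => h t) := by
    refine Continuous.measurableEmbedding (by fun_prop) fun h₁ h₂ h => ?_
    refine DFunLike.coe_injective (h₁.continuous.ext_on hsd h₂.continuous fun t ht => ?_)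
    exact congrFun h ⟨t, ht⟩
  exact hemb.aemeasurable_comp_iff.1 (aemeasurable_pi_iff.2 fun t => hφ t)

/-- The strong law of large numbers, uniformly over a compact parameter space: the parametrized
function is a random element of the separable Banach space `C(T, E)`, integrable in norm because of
the envelope `g`, and the strong law for Banach-valued variables applies to it. -/
theorem uniform_strong_law {T E D Ω : Type*} [TopologicalSpace T] [CompactSpace T]
    [T2Space T] [SecondCountableTopology T] [NormedAddCommGroup E] [NormedSpace ℝ E]
    [CompleteSpace E] [SecondCountableTopology E] [MeasurableSpace D] {P : Measure D}
    {f : T → D → E} (hcont : ∀ᵐ x ∂P, Continuous fun t => f t x)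
    (hmeas : ∀ t, AEStronglyMeasurable (f t) P)
    {g : D → ℝ} (hg : Integrable g P) (hbound : ∀ᵐ x ∂P, ∀ t, ‖f t x‖ ≤ g x)
    [MeasurableSpace Ω] {μ : Measure Ω} {X : ℕ → Ω → D} (hlaw : ∀ i, HasLaw (X i) P μ)
    (hindep : iIndepFun X μ) :
    Continuous (fun t => ∫ x, f t x ∂P) ∧
      ∀ᵐ ω ∂μ, TendstoUniformly
        (fun (N : ℕ) t => (N : ℝ)⁻¹ • ∑ i ∈ Finset.range N, f t (X i ω))
        (fun t => ∫ x, f t x ∂P) atTop := by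
  classical
  borelize E
  borelize C(T, E)
  -- the value on the null set of discontinuous sections is immaterial
  let φ : D → C(T, E) := fun x => if h : Continuous fun t => f t x then ⟨_, h⟩ else 0
  have hφ : ∀ x, (Continuous fun t => f t x) → ∀ t, φ x t = f t x := fun x h t => by
    simp [φ, h]
  have hφae : ∀ᵐ x ∂P, ∀ t, φ x t = f t x := hcont.mono hφ
  have hφm : AEMeasurable φ P := aemeasurable_continuousMap fun t =>
    (hmeas t).aemeasurable.congr (hφae.mono fun x hx => (hx t).symm)
  have hφint : Integrable φ P := by
    refine hg.abs.mono' hφm.aestronglyMeasurable ?_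
    filter_upwards [hφae, hbound] with x hx hb
    exact (ContinuousMap.norm_le _ (abs_nonneg _)).2 fun t =>
      (hx t).symm ▸ (hb t).trans (le_abs_self _)
  have hmean : ∀ t, (∫ x, φ x ∂P) t = ∫ x, f t x ∂P := fun t => by
    rw [ContinuousMap.integral_apply hφint]
    exact integral_congr_ae (hφae.mono fun x hx => hx t)
  have hmean' : (fun t => ∫ x, f t x ∂P) = ⇑(∫ x, φ x ∂P) := funext fun t => (hmean t).symm
  refine ⟨hmean' ▸ (∫ x, φ x ∂P).continuous, ?_⟩
  have hφX : ∀ i, AEMeasurable φ (μ.map (X i)) := fun i => (hlaw i).map_eq ▸ hφm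
  have hident : ∀ i, IdentDistrib (X i) (X 0) μ μ := fun i =>
    ⟨(hlaw i).aemeasurable, (hlaw 0).aemeasurable, (hlaw i).map_eq.trans (hlaw 0).map_eq.symm⟩
  have hslln := strong_law_ae (μ := μ) (fun i => φ ∘ X i)
    (Integrable.comp_aemeasurable ((hlaw 0).map_eq ▸ hφint) (hlaw 0).aemeasurable)
    (fun i j hij => (hindep.indepFun hij).comp₀ (hlaw i).aemeasurable (hlaw j).aemeasurable
      (hφX i) (hφX j))
    (fun i => (hident i).comp_of_aemeasurable (hφX i))
  have hsample : ∀ᵐ ω ∂μ, ∀ i t, φ (X i ω) t = f t (X i ω) := ae_all_iff.2 fun i =>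
    ae_of_ae_map (hlaw i).aemeasurable ((hlaw i).map_eq ▸ hφae)
  have hexp : μ[φ ∘ X 0] = ∫ x, φ x ∂P :=
    (hlaw 0).integral_comp hφint.aestronglyMeasurable
  rw [hexp] at hslln
  filter_upwards [hslln, hsample] with ω hω hs
  rw [hmean']
  simpa [hs] using ContinuousMap.tendsto_iff_tendstoUniformly.1 hω

/-- The uniform strong law over a compact set of parameters, in terms of empirical measures. -/
theorem uniform_strong_law_empiricalMeasure {α : Type*} [TopologicalSpace α] [T2Space α]
    [SecondCountableTopology α] {C : Set α} (hC : IsCompact C) {m d : ℕ} {P : Measure (Vec m)}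
    {f : α → Vec m → Vec d} (hcont : ∀ᵐ x ∂P, ContinuousOn (fun t => f t x) C)
    (hmeas : ∀ t ∈ C, AEStronglyMeasurable (f t) P)
    {g : Vec m → ℝ} (hg : Integrable g P) (hbound : ∀ᵐ x ∂P, ∀ t ∈ C, ‖f t x‖ ≤ g x)
    {Ω : Type*} [MeasurableSpace Ω] {μ : Measure Ω} {X : ℕ → Ω → Vec m}
    (hlaw : ∀ i, HasLaw (X i) P μ) (hindep : iIndepFun X μ) :
    ContinuousOn (fun t => ∫ x, f t x ∂P) C ∧
      ∀ᵐ ω ∂μ, TendstoUniformlyOn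
        (fun N t => ∫ x, f t x ∂(empiricalMeasure (fun i => X i ω) N))
        (fun t => ∫ x, f t x ∂P) atTop C := by
  have : CompactSpace C := isCompact_iff_compactSpace.1 hC
  obtain ⟨h₁, h₂⟩ := uniform_strong_law (f := fun t : C => f t)
    (hcont.mono fun x hx => continuousOn_iff_continuous_domRestrict.1 hx) (fun t => hmeas t t.2) hg
    (hbound.mono fun x hx t => hx t t.2) hlaw hindep
  refine ⟨continuousOn_iff_continuous_domRestrict.2 h₁, h₂.mono fun ω hω => ?_⟩
  rw [tendstoUniformlyOn_iff_restrict]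
  simp only [integral_empiricalMeasure]
  exact hω

/-! ### Uniform convergence of compositions -/

/-- If `v N → v` uniformly on `K` and `v` maps the compact set `K` into the interior of `J`, then
`v N` maps `K` into `J` for large `N`, because the image of `K` keeps a positive distance from the
complement of `J`. -/
theorem eventually_mapsTo_of_tendstoUniformlyOn {α β ι : Type*} [TopologicalSpace α]
    [PseudoMetricSpace β] {l : Filter ι} {K : Set α} (hK : IsCompact K) {J : Set β}
    {V : ι → α → β} {v : α → β} (hv : ContinuousOn v K) (hVv : TendstoUniformlyOn V v l K)
    (hvJ : Set.MapsTo v K (interior J)) : ∀ᶠ i in l, Set.MapsTo (V i) K J := by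
  obtain ⟨δ, hδ, hsub⟩ := (hK.image_of_continuousOn hv).exists_thickening_subset_open
    isOpen_interior hvJ.image_subset
  filter_upwards [Metric.tendstoUniformlyOn_iff.1 hVv δ hδ] with i hi u hu
  exact interior_subset <| hsub <| Metric.mem_thickening_iff.2
    ⟨v u, Set.mem_image_of_mem v hu, by simpa [dist_comm] using hi u hu⟩

theorem continuousOn_comp_prodMk {α β γ : Type*} [TopologicalSpace α] [TopologicalSpace β]
    [TopologicalSpace γ] {K : Set α} {J : Set β} {h : α → β → γ} {v : α → β}
    (hh : ContinuousOn (Function.uncurry h) (K ×ˢ J)) (hv : ContinuousOn v K)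
    (hvJ : Set.MapsTo v K J) : ContinuousOn (fun u => h u (v u)) K :=
  hh.comp (continuousOn_id.prodMk hv) fun _ hu => ⟨hu, hvJ hu⟩

/-- Uniform convergence passes through the substitution `u ↦ h u (v u)`: the outer functions are
compared at the same inner point, and the inner ones through the uniform continuity of `h` on the
compact set `K ×ˢ J`. -/
theorem tendstoUniformlyOn_comp_prodMk {α β γ ι : Type*} [PseudoMetricSpace α]
    [PseudoMetricSpace β] [PseudoMetricSpace γ] {l : Filter ι} {K : Set α} (hK : IsCompact K)
    {J : Set β} (hJ : IsCompact J) {H : ι → α → β → γ} {h : α → β → γ}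
    (hh : ContinuousOn (Function.uncurry h) (K ×ˢ J))
    (hHh : TendstoUniformlyOn (fun i => Function.uncurry (H i)) (Function.uncurry h) l (K ×ˢ J))
    {V : ι → α → β} {v : α → β} (hv : ContinuousOn v K) (hVv : TendstoUniformlyOn V v l K)
    (hvJ : Set.MapsTo v K (interior J)) :
    TendstoUniformlyOn (fun i u => H i u (V i u)) (fun u => h u (v u)) l K := by
  have hmaps := eventually_mapsTo_of_tendstoUniformlyOn hK hv hVv hvJ
  have huc : UniformContinuousOn (Function.uncurry h) (K ×ˢ J) :=
    (hK.prod hJ).uniformContinuousOn_of_continuous hh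
  have hid : TendstoUniformlyOn (fun (_ : ι) (u : α) => u) id l K :=
    Metric.tendstoUniformlyOn_iff.2 fun ε hε => by simp [hε]
  have hpair : TendstoUniformlyOn (fun i u => (u, V i u)) (fun u => (u, v u)) l K := by
    refine Metric.tendstoUniformlyOn_iff.2 fun ε hε => ?_
    filter_upwards [Metric.tendstoUniformlyOn_iff.1 hVv ε hε] with i hi u hu
    simpa [Prod.dist_eq, hε] using hi u hu
  have hinner := huc.comp_tendstoUniformlyOn_eventually (s := K ×ˢ J) (p := l) (t := K)
    (hmaps.mono fun i hi u hu => ⟨hu, hi hu⟩) (fun u hu => ⟨hu, interior_subset (hvJ hu)⟩) hpair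
  refine Metric.tendstoUniformlyOn_iff.2 fun ε hε => ?_
  filter_upwards [hmaps, Metric.tendstoUniformlyOn_iff.1 hinner _ (half_pos hε),
    Metric.tendstoUniformlyOn_iff.1 hHh _ (half_pos hε)] with i hi h₁ h₂ u hu
  calc dist (h u (v u)) (H i u (V i u))
      ≤ dist (h u (v u)) (h u (V i u)) + dist (h u (V i u)) (H i u (V i u)) := dist_triangle _ _ _
    _ < ε / 2 + ε / 2 := add_lt_add (h₁ u hu) (h₂ (u, V i u) ⟨hu, hi hu⟩)
    _ = ε := add_halves ε

/-- Backward induction over the levels: the nested values for `P` are continuous on `K`, those for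
`Q N` converge to them uniformly on `K`, and the values at the inner levels stay in the interiors of
the sets `I i`, where the averaged functions of the next level are controlled. -/
theorem Model.nested_tendstoUniformlyOn {n m : ℕ} {ι : Type*} {l : Filter ι} (F : Model n m)
    {P : Measure (Vec m)} {Q : ι → Measure (Vec m)} {K : Set (Vec n)} (hK : IsCompact K)
    {I : (i : Fin (F.k + 1)) → Set (Vec (F.dim i))} (hI : ∀ j : Fin F.k, IsCompact (I j.succ))
    (hIstep : ∀ j : Fin F.k, j.castSucc ≠ 0 →
      ∀ u ∈ K, ∀ η ∈ I j.succ, F.fbar P j u η ∈ interior (I j.castSucc))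
    (hIlast : ∀ u ∈ K, F.fbarLast P u ∈ interior (I (Fin.last F.k)))
    (hcont : ∀ j, ContinuousOn (Function.uncurry (F.fbar P j)) (K ×ˢ I j.succ))
    (hcontLast : ContinuousOn (F.fbarLast P) K)
    (hconv : ∀ j, TendstoUniformlyOn (fun N => Function.uncurry (F.fbar (Q N) j))
      (Function.uncurry (F.fbar P j)) l (K ×ˢ I j.succ))
    (hconvLast : TendstoUniformlyOn (fun N => F.fbarLast (Q N)) (F.fbarLast P) l K)
    (i : Fin (F.k + 1)) :
    ContinuousOn (fun u => F.nested P u i) K ∧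
      TendstoUniformlyOn (fun N u => F.nested (Q N) u i) (fun u => F.nested P u i) l K ∧
      (i ≠ 0 → Set.MapsTo (fun u => F.nested P u i) K (interior (I i))) := by
  induction i using Fin.reverseInduction with
  | last =>
    simp only [F.nested_last]
    exact ⟨hcontLast, hconvLast, fun _ => hIlast⟩
  | cast j ih =>
    obtain ⟨hc, ht, hm⟩ := ih
    replace hm := hm j.succ_ne_zero
    simp only [F.nested_castSucc]
    exact ⟨continuousOn_comp_prodMk (hcont j) hc (hm.mono_right interior_subset),
      tendstoUniformlyOn_comp_prodMk hK (hI j) (hcont j) (hconv j) hc ht hm,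
      fun h0 u hu => hIstep j h0 u hu _ (interior_subset (hm hu))⟩

/-! ### Stability of minimization under uniform convergence -/

section Minimization

variable {n : ℕ} {ι : Type*} {l : Filter ι} {U K : Set (Vec n)} {φ : Vec n → ℝ}
  {Φ : ι → Vec n → ℝ}

/-- The optimal values converge: each one is attained on `K`, where the two functions differ by
less than `ε` in the end. -/
theorem tendsto_optimalValue (hS : (solutionSet U φ).Nonempty) (hSK : solutionSet U φ ⊆ K)
    (hΦφ : TendstoUniformlyOn Φ φ l K)
    (hSN : ∀ᶠ N in l, (solutionSet U (Φ N)).Nonempty ∧ solutionSet U (Φ N) ⊆ K) :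
    Tendsto (fun N => optimalValue U (Φ N)) l (𝓝 (optimalValue U φ)) := by
  obtain ⟨s, hs⟩ := hS
  refine Metric.tendsto_nhds.2 fun ε hε => ?_
  filter_upwards [hSN, Metric.tendstoUniformlyOn_iff.1 hΦφ ε hε] with N ⟨⟨t, ht⟩, hsub⟩ hN
  rw [optimalValue_eq hs, optimalValue_eq ht, Real.dist_eq, abs_lt]
  have h₁ := abs_lt.1 (hN s (hSK hs))
  have h₂ := abs_lt.1 (hN t (hsub ht))
  have h₃ : φ s ≤ φ t := hs.2 ht.1
  have h₄ : Φ N t ≤ Φ N s := ht.2 hs.1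
  constructor <;> linarith [h₁.1, h₁.2, h₂.1, h₂.2]

/-- The minimizers of the approximations approach those of the limit: on the compact set of the
points of `K` at distance at least `ε` from the solution set, `φ` exceeds its optimal value by a
positive gap, which forbids these points to be approximate minimizers. -/
theorem tendsto_oneSidedDist_solutionSet (hK : IsCompact K) (hKU : K ⊆ U)
    (hφ : ContinuousOn φ K) (hS : (solutionSet U φ).Nonempty) (hSK : solutionSet U φ ⊆ K)
    (hΦφ : TendstoUniformlyOn Φ φ l K)
    (hSN : ∀ᶠ N in l, solutionSet U (Φ N) ⊆ K) :
    Tendsto (fun N => oneSidedDist (solutionSet U (Φ N)) (solutionSet U φ)) l (𝓝 0) := by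
  obtain ⟨s, hs⟩ := hS
  refine ENNReal.tendsto_nhds_zero.2 fun ε hε => ?_
  let A : Set (Vec n) := K ∩ {u | ε ≤ Metric.infEDist u (solutionSet U φ)}
  have hA : IsCompact A := hK.inter_right (isClosed_le continuous_const Metric.continuous_infEDist)
  have hgap : ∃ δ > 0, ∀ u ∈ A, φ s + δ ≤ φ u := by
    rcases A.eq_empty_or_nonempty with hAe | hAne
    · exact ⟨1, one_pos, by simp [hAe]⟩
    obtain ⟨a, ha, hmin⟩ := hA.exists_isMinOn hAne (hφ.mono Set.inter_subset_left)
    refine ⟨φ a - φ s, sub_pos.2 (lt_of_not_ge fun hle => ?_), fun u hu => by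
      simpa using hmin hu⟩
    -- without a gap, the minimizer `a` of `φ` on `A` would be a solution, at distance zero
    have haS : a ∈ solutionSet U φ := ⟨hKU ha.1, fun v hv => hle.trans (hs.2 hv)⟩
    have : ε ≤ Metric.infEDist a (solutionSet U φ) := ha.2
    rw [Metric.infEDist_zero_of_mem haS] at this
    exact hε.not_ge this
  obtain ⟨δ, hδ, hgap⟩ := hgap
  filter_upwards [hSN, Metric.tendstoUniformlyOn_iff.1 hΦφ (δ / 2) (half_pos hδ)] with N hsub hN
  refine iSup₂_le fun t ht => le_of_not_ge fun hlt => ?_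
  have h₁ := abs_lt.1 (hN s (hSK hs))
  have h₂ := abs_lt.1 (hN t (hsub ht))
  have h₃ : φ s + δ ≤ φ t := hgap t ⟨hsub ht, hlt⟩
  have h₄ : Φ N t ≤ Φ N s := ht.2 hs.1
  linarith [h₁.1, h₂.2]

/-- The distance of a single point to a nonempty set is at most the one-sided distance of that set
to the point, so one of the two one-sided distances controls the other. -/
theorem pompeiuHausdorffDist_singleton {A : Set (Vec n)} (hA : A.Nonempty) (s : Vec n) :
    pompeiuHausdorffDist A {s} = oneSidedDist A {s} := by
  obtain ⟨a, ha⟩ := hA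
  refine max_eq_left ?_
  calc oneSidedDist {s} A = Metric.infEDist s A := by simp [oneSidedDist]
    _ ≤ edist s a := Metric.infEDist_le_edist_of_mem ha
    _ = Metric.infEDist a {s} := by rw [Metric.infEDist_singleton, edist_comm]
    _ ≤ oneSidedDist A {s} := le_iSup₂_of_le a ha le_rfl

end Minimization

end CompositeOpt

/-! ### Consistency of the empirical problem -/

open CompositeOpt in
theorem mainTheorem3 {n m : ℕ} (F : Model n m)
    -- the law of the random vector, carried by the set of its realizations
    (P : Measure (Vec m)) [IsProbabilityMeasure P]
    (𝒳 : Set (Vec m)) (h𝒳 : ∀ᵐ x ∂P, x ∈ 𝒳)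
    -- the feasible set
    (U : Set (Vec n)) (hU : IsClosed U)
    -- joint continuity in the decision and the nested argument
    (hcont : ∀ x ∈ 𝒳, ∀ j : Fin F.k,
      Continuous fun p : Vec n × Vec (F.dim j.succ) => F.f j p.1 p.2 x)
    (hcontLast : ∀ x ∈ 𝒳, Continuous fun u : Vec n => F.fLast u x)
    -- integrability in the last argument
    (hint : ∀ u ∈ U, ∀ (j : Fin F.k) (η : Vec (F.dim j.succ)), Integrable (F.f j u η) P)
    (hintLast : ∀ u ∈ U, Integrable (F.fLast u) P)
    -- the set of solutions is nonempty, and contained in the compact set `K ⊆ U`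
    (hS : (solutionSet U (F.risk P)).Nonempty)
    (K : Set (Vec n)) (hK : IsCompact K) (hSK : solutionSet U (F.risk P) ⊆ K) (hKU : K ⊆ U)
    -- the compact sets `I_1, …, I_k` (`I 0` plays no role if `k ≥ 1`)
    (I : (i : Fin (F.k + 1)) → Set (Vec (F.dim i)))
    (hI : ∀ j : Fin F.k, IsCompact (I j.succ))
    (hIstep : ∀ j : Fin F.k, j.castSucc ≠ 0 →
      ∀ u ∈ K, ∀ η ∈ I j.succ, F.fbar P j u η ∈ interior (I j.castSucc))
    (hIlast : ∀ u ∈ K, F.fbarLast P u ∈ interior (I (Fin.last F.k)))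
    -- integrable envelopes, uniform in `(u, η_j) ∈ K × I_j`
    (g : Fin F.k → Vec m → ℝ) (gLast : Vec m → ℝ)
    (hg : ∀ j, Integrable (g j) P) (hgLast : Integrable gLast P)
    (hbound : ∀ j : Fin F.k, ∀ u ∈ K, ∀ η ∈ I j.succ, ∀ x ∈ 𝒳, ‖F.f j u η x‖ ≤ g j x)
    (hboundLast : ∀ u ∈ K, ∀ x ∈ 𝒳, ‖F.fLast u x‖ ≤ gLast x)
    -- the independent sample from `P`
    {Ω : Type*} [MeasurableSpace Ω] (μ : Measure Ω) [IsProbabilityMeasure μ]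
    (X : ℕ → Ω → Vec m) (hlaw : ∀ i, HasLaw (X i) P μ) (hindep : iIndepFun X μ)
    -- a.s., for large `N`, the empirical problem has solutions, and all of them lie in `K`
    (hSN : ∀ᵐ ω ∂μ, ∀ᶠ N in atTop,
      (solutionSet U (F.risk (empiricalMeasure (fun i => X i ω) N))).Nonempty ∧
        solutionSet U (F.risk (empiricalMeasure (fun i => X i ω) N)) ⊆ K) :
    (∀ u ∈ K, ∀ᵐ ω ∂μ,
      Tendsto (fun N => F.risk (empiricalMeasure (fun i => X i ω) N) u) atTop
        (𝓝 (F.risk P u))) ∧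
    (∀ᵐ ω ∂μ,
      Tendsto (fun N => optimalValue U (F.risk (empiricalMeasure (fun i => X i ω) N))) atTop
        (𝓝 (optimalValue U (F.risk P)))) ∧
    (∀ᵐ ω ∂μ,
      Tendsto (fun N => oneSidedDist
          (solutionSet U (F.risk (empiricalMeasure (fun i => X i ω) N)))
          (solutionSet U (F.risk P))) atTop
        (𝓝 0)) ∧
    ((∃! u, u ∈ solutionSet U (F.risk P)) →
      ∀ᵐ ω ∂μ,
        Tendsto (fun N => pompeiuHausdorffDist
            (solutionSet U (F.risk (empiricalMeasure (fun i => X i ω) N)))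
            (solutionSet U (F.risk P))) atTop
          (𝓝 0)) := by
  -- the averaged functions obey a uniform strong law at every level
  have hlevel := fun j : Fin F.k => uniform_strong_law_empiricalMeasure (hK.prod (hI j))
    (f := fun p x => F.f j p.1 p.2 x)
    (h𝒳.mono fun x hx => (hcont x hx j).continuousOn)
    (fun p hp => (hint p.1 (hKU hp.1) j p.2).aestronglyMeasurable) (hg j)
    (h𝒳.mono fun x hx p hp => hbound j p.1 hp.1 p.2 hp.2 x hx) hlaw hindep
  have hlast := uniform_strong_law_empiricalMeasure hK (f := F.fLast)
    (h𝒳.mono fun x hx => (hcontLast x hx).continuousOn)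
    (fun u hu => (hintLast u (hKU hu)).aestronglyMeasurable) hgLast
    (h𝒳.mono fun x hx u hu => hboundLast u hu x hx) hlaw hindep
  have hnested : ∀ᵐ ω ∂μ, ContinuousOn (fun u => F.nested P u 0) K ∧
      TendstoUniformlyOn (fun N u => F.nested (empiricalMeasure (fun i => X i ω) N) u 0)
        (fun u => F.nested P u 0) atTop K := by
    filter_upwards [ae_all_iff.2 fun j => (hlevel j).2, hlast.2] with ω hω hωlast
    have h := F.nested_tendstoUniformlyOn hK hI hIstep hIlast (fun j => (hlevel j).1) hlast.1
      hω hωlast 0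
    exact ⟨h.1, h.2.1⟩
  have hrisk : ∀ᵐ ω ∂μ, ContinuousOn (F.risk P) K ∧
      TendstoUniformlyOn (fun N => F.risk (empiricalMeasure (fun i => X i ω) N)) (F.risk P)
        atTop K := by
    filter_upwards [hnested] with ω ⟨hc, ht⟩
    let e : Vec (F.dim 0) →L[ℝ] ℝ := EuclideanSpace.proj (Fin.cast F.dim_zero.symm 0)
    exact ⟨e.continuous.comp_continuousOn hc, e.uniformContinuous.comp_tendstoUniformlyOn ht⟩
  have hdist : ∀ᵐ ω ∂μ,
      Tendsto (fun N => oneSidedDist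
          (solutionSet U (F.risk (empiricalMeasure (fun i => X i ω) N)))
          (solutionSet U (F.risk P))) atTop (𝓝 0) := by
    filter_upwards [hrisk, hSN] with ω ⟨hc, ht⟩ hω
    exact tendsto_oneSidedDist_solutionSet hK hKU hc hS hSK ht (hω.mono fun N h => h.2)
  refine ⟨fun u hu => hrisk.mono fun ω h => h.2.tendsto_at hu, ?_, hdist, ?_⟩
  · filter_upwards [hrisk, hSN] with ω h hω
    exact tendsto_optimalValue hS hSK h.2 hω
  · rintro ⟨s, hs, huniq⟩
    have hSs : solutionSet U (F.risk P) = {s} := Set.eq_singleton_iff_unique_mem.2 ⟨hs, huniq⟩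
    filter_upwards [hdist, hSN] with ω hd hω
    refine hd.congr' (hω.mono fun N h => ?_)
    simp only [hSs, pompeiuHausdorffDist_singleton h.1]
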